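/- Let $X$ be a compact one-dimensional complex manifold and let $S\subset X$ be a finite Riemann surface, that is, a nonempty open subset containing no connected component of $X$, such that $\partial S=\partial(\overline S)$ and $\partial S$ is the union of finitely many pairwise disjoint simple closed analytic curves ($X$ and $S$ need not be connected). Here a simple closed analytic curve is the image of the unit circle under an injective holomorphic map of an open neighbourhood of the circle into $X$. Let $H$ be a complex Hilbert space of any dimension, for example $\mathbb C^d$ or $\ell^2$, with open unit ball $\mathbb B$ and unit sphere $\partial\mathbb B$, and let $f:S\to\mathbb B$ be a holomorphic map. (1) Let $x_0\in\partial S$. If $f$ extends to a $C^1$ map on $S\cup\{x_0\}$ with $f(x_0)\in\partial\mathbb B$, then $f(S)$ meets $\partial\mathbb B$ transversally at $f(x_0)$: the derivative $df_{x_0}:T_{x_0}X\to H$ of the extension exists as a complex linear map and $\langle f(x_0),df_{x_0}(v)\rangle\neq0$ for every nonzero $v\in T_{x_0}X$. (In a local parameter $z$ at $x_0$, this says $\langle f(x_0),\tfrac{df}{dz}(x_0)\rangle\ne0$.) (2) Consequently transversality need not be assumed for maps that are $C^1$ up to the boundary: if $f$ extends to a $C^1$ map on $\overline S$, then $f(S)$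 meets $\partial\mathbb B$ transversally, in the same sense, at $f(x)$ for every $x\in\partial S$ with $f(x)\in\partial\mathbb B$. -/

import Mathlib

open scoped Manifold ContDiff

/-- A simple closed analytic curve in a Riemann surface `X`: the image of the unit circle under
an injective holomorphic map defined on an open neighbourhood of the circle in `ℂ`. -/
def IsSimpleClosedAnalyticCurve {X : Type*} [TopologicalSpace X] [ChartedSpace ℂ X]
    (C : Set X) : Prop :=
  ∃ (U : Set ℂ) (γ : ℂ → X), IsOpen U ∧ Metric.sphere (0 : ℂ) 1 ⊆ U ∧
    MDifferentiableOn 𝓘(ℂ, ℂ) 𝓘(ℂ, ℂ) γ U ∧ Set.InjOn γ U ∧ C = γ '' Metric.sphere (0 : ℂ) 1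

/-- `S` is a finite Riemann surface inside the compact one-dimensional complex manifold `X`:
a nonempty open subset, containing no component of `X`, whose boundary is the union of finitely
many pairwise disjoint simple closed analytic curves and is also the boundary of its closure.
Neither `X` nor `S` has to be connected: in general `S` is a finite disjoint union of connected
finite Riemann surfaces. For connected `X` the second condition says that `S ≠ X`. -/
structure IsFiniteRiemannSurface {X : Type*} [TopologicalSpace X] [ChartedSpace ℂ X]
    (S : Set X) : Prop where
  nonempty : S.Nonempty
  isOpen : IsOpen S
  not_component_subset : ∀ x : X, ¬ connectedComponent x ⊆ S
  frontier_closure : frontier (closure S) = frontier S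
  exists_curves : ∃ 𝒞 : Set (Set X), 𝒞.Finite ∧ 𝒞.PairwiseDisjoint id ∧
    (∀ C ∈ 𝒞, IsSimpleClosedAnalyticCurve C) ∧ ⋃₀ 𝒞 = frontier S

/-- The map `f`, regarded on the set `T` (a surface together with one or all of its boundary
points), meets the unit sphere transversally at the boundary point `x`: it has a complex linear
derivative `f'` at `x` relative to `T`, and `⟨f x, f' v⟩ ≠ 0` for each nonzero tangent vector `v`
at `x`. In a local parameter `z` at `x` the vectors `f' v`, `v ≠ 0`, are the nonzero multiples
of `df/dz`, so that this says `⟨f x, df/dz⟩ ≠ 0`. -/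
def MeetsSphereTransversallyAt {X : Type*} [TopologicalSpace X] [ChartedSpace ℂ X]
    {H : Type*} [NormedAddCommGroup H] [InnerProductSpace ℂ H]
    (f : X → H) (T : Set X) (x : X) : Prop :=
  ∃ f' : TangentSpace 𝓘(ℂ, ℂ) x →L[ℂ] H,
    HasMFDerivWithinAt 𝓘(ℂ, ℂ) 𝓘(ℂ, H) f T x f' ∧
      ∀ v : TangentSpace 𝓘(ℂ, ℂ) x, v ≠ 0 → inner ℂ (f x) (f' v) ≠ 0

/-!
Pair `f` with the value `f x` of norm one: `z ↦ ⟪f x, f z⟫` is holomorphic on `S`, and its real part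
is less than `1` there, with value `1` at `x`. The boundary curve has a holomorphic extension, so
`S` contains the image, under a holomorphic map `Γ`, of a disc whose boundary circle passes through
`Γ⁻¹ x`. On this disc the claim is Hopf's lemma: if `re G < re a` on a disc, the Borel–Carathéodory
inequality for `(G - a)⁻¹`, whose real part is negative, shows that `|G - a|` is at least a constant
times the distance to the boundary circle, so `G` cannot have zero derivative at a boundary point
where its value is `a`. The derivative of the `C¹` extension at the boundary is complex linear as a
limit of complex linear maps.
-/

open Asymptotics Complex Filter Metric Set Topology

theorem isBigO_sub_dist_of_re_lt {G : ℂ → ℂ} {a c : ℂ} {R : ℝ}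
    (hG : DifferentiableOn ℂ G (ball c R)) (ha : ∀ z ∈ ball c R, (G z).re < a.re) :
    (fun z => R - dist z c) =O[𝓟 (ball c R)] fun z => G z - a := by
  refine isBigO_principal.2 ⟨2 * R * (1 + ‖(G c - a)⁻¹‖), fun z hz => ?_⟩
  have hR : 0 < R := dist_nonneg.trans_lt hz
  have hzR : ‖z - c‖ < R := by rwa [← dist_eq_norm]
  have hre {w : ℂ} (hw : w ∈ ball c R) : (G w - a).re < 0 := sub_neg.2 (ha w hw)
  have hne {w : ℂ} (hw : w ∈ ball c R) : G w - a ≠ 0 := fun h => by simpa [h] using hre hw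
  have hshift : MapsTo (· + c) (ball 0 R) (ball c R) := fun w hw => by simpa using hw
  have hdiff : DifferentiableOn ℂ (fun w => (G (w + c) - a)⁻¹) (ball 0 R) :=
    ((hG.comp (by fun_prop) hshift).sub_const a).inv fun w hw => hne (hshift hw)
  have hneg : MapsTo (fun w => (G (w + c) - a)⁻¹) (ball 0 R) {w | w.re ≤ 1} := fun w hw =>
    (inv_re (G (w + c) - a) ▸ div_nonpos_of_nonpos_of_nonneg (hre (hshift hw)).le
      (normSq_nonneg _)).trans zero_le_one
  have hbound := borelCaratheodory one_pos hdiff hneg hR (mem_ball_zero_iff.2 hzR)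
  rw [← add_div, le_div_iff₀ (sub_pos.2 hzR)] at hbound
  simp only [sub_add_cancel, zero_add, norm_inv] at hbound
  rw [inv_mul_le_iff₀ (norm_pos_iff.2 (hne hz))] at hbound
  rw [Real.norm_of_nonneg (sub_nonneg.2 hz.le), dist_eq_norm, norm_inv]
  calc R - ‖z - c‖ ≤ ‖G z - a‖ * (2 * 1 * ‖z - c‖ + ‖G c - a‖⁻¹ * (R + ‖z - c‖)) := hbound
    _ ≤ ‖G z - a‖ * (2 * 1 * R + ‖G c - a‖⁻¹ * (R + R)) := by gcongr
    _ = 2 * R * (1 + ‖G c - a‖⁻¹) * ‖G z - a‖ := by ring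

theorem hasFDerivWithinAt_ne_zero_of_re_lt {G : ℂ → ℂ} {G' : ℂ →L[ℂ] ℂ} {c p : ℂ}
    {R : ℝ} (hp : p ∈ sphere c R) (hR : R ≠ 0) (hG : DifferentiableOn ℂ G (ball c R))
    (hre : ∀ z ∈ ball c R, (G z).re < (G p).re)
    (hG' : HasFDerivWithinAt G G' (insert p (ball c R)) p) : G' ≠ 0 := by
  rintro rfl
  have hR0 : 0 < R := (nonneg_of_mem_sphere hp).lt_of_ne' hR
  let γ : ℝ → ℂ := AffineMap.lineMap p c
  have hdist_center {t : ℝ} (ht : t ∈ Ioo 0 1) : dist (γ t) c = (1 - t) * R := by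
    rw [dist_lineMap_right, mem_sphere.1 hp, Real.norm_of_nonneg (sub_nonneg.2 ht.2.le)]
  have hγ_ball : ∀ᶠ t in 𝓝[>] (0 : ℝ), γ t ∈ ball c R := by
    filter_upwards [Ioo_mem_nhdsGT one_pos] with t ht
    rw [mem_ball, hdist_center ht]
    nlinarith [ht.1]
  have hγ : Tendsto γ (𝓝[>] 0) (𝓝[insert p (ball c R)] p) := by
    refine tendsto_nhdsWithin_iff.2 ⟨?_, hγ_ball.mono fun t ht => mem_insert_of_mem p ht⟩
    simpa [γ] using (AffineMap.lineMap_continuous (R := ℝ) (p := p) (q := c)).tendsto 0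
      |>.mono_left nhdsWithin_le_nhds
  have hlower : (fun t => R - dist (γ t) c) =O[𝓝[>] 0] fun t => G (γ t) - G p :=
    (isBigO_sub_dist_of_re_lt hG hre).comp_tendsto (tendsto_principal.2 hγ_ball)
  have hupper : (fun t => G (γ t) - G p) =o[𝓝[>] 0] fun t => γ t - p := by
    simpa [Function.comp_def] using hG'.isLittleO.comp_tendsto hγ
  have hlittle : (fun t : ℝ => t * R) =o[𝓝[>] 0] fun t : ℝ => t * R := by
    refine (hlower.trans_isLittleO hupper).norm_right.congr' ?_ ?_ <;>
      filter_upwards [Ioo_mem_nhdsGT one_pos] with t ht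
    · rw [hdist_center ht]
      ring
    · rw [← dist_eq_norm, dist_lineMap_left, mem_sphere.1 hp, Real.norm_of_nonneg ht.1.le]
  refine isLittleO_irrefl (Eventually.frequently ?_) hlittle
  filter_upwards [self_mem_nhdsWithin] with t ht using (mul_pos ht hR0).ne'

theorem inner_hasFDerivWithinAt_ne_zero_of_norm_lt {H : Type*} [NormedAddCommGroup H]
    [InnerProductSpace ℂ H] {g : ℂ → H} {g' : ℂ →L[ℂ] H} {c p : ℂ} {R : ℝ}
    (hp : p ∈ sphere c R) (hR : R ≠ 0) (hg : DifferentiableOn ℂ g (ball c R))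
    (hnorm : ∀ z ∈ ball c R, ‖g z‖ < ‖g p‖)
    (hg' : HasFDerivWithinAt g g' (insert p (ball c R)) p) : inner ℂ (g p) (g' 1) ≠ 0 := by
  have hre : ∀ z ∈ ball c R, (inner ℂ (g p) (g z)).re < (inner ℂ (g p) (g p)).re := fun z hz =>
    calc (inner ℂ (g p) (g z)).re ≤ ‖g p‖ * ‖g z‖ := re_inner_le_norm (𝕜 := ℂ) _ _
      _ < ‖g p‖ * ‖g p‖ := by
        gcongr
        · exact (norm_nonneg _).trans_lt (hnorm z hz)
        · exact hnorm z hz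
      _ = (inner ℂ (g p) (g p)).re := (inner_self_eq_norm_mul_norm (𝕜 := ℂ) _).symm
  have hne := hasFDerivWithinAt_ne_zero_of_re_lt hp hR
    ((innerSL ℂ (g p)).differentiable.comp_differentiableOn hg) hre
    ((innerSL ℂ (g p)).hasFDerivAt.comp_hasFDerivWithinAt p hg')
  exact fun h => hne (ContinuousLinearMap.ext_ring h)

theorem exists_hasFDerivWithinAt_of_contDiffWithinAt {𝕜 𝕜' E F : Type*}
    [NontriviallyNormedField 𝕜] [NontriviallyNormedField 𝕜'] [NormedAlgebra 𝕜 𝕜']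
    [NormedAddCommGroup E] [NormedSpace 𝕜 E] [NormedSpace 𝕜' E] [IsScalarTower 𝕜 𝕜' E]
    [NormedAddCommGroup F] [NormedSpace 𝕜 F] [NormedSpace 𝕜' F] [IsScalarTower 𝕜 𝕜' F]
    {f : E → F} {s t : Set E} {x : E} (hft : ContDiffWithinAt 𝕜 1 f t x) (hs : IsOpen s)
    (hst : s ⊆ t) (hfs : DifferentiableOn 𝕜' f s) (hx : x ∈ closure s) :
    ∃ f' : E →L[𝕜'] F, HasFDerivWithinAt f f' t x := by
  obtain ⟨u, hu, -, f', hf', hf'_cont⟩ :=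
    (contDiffWithinAt_succ_iff_hasFDerivWithinAt (n := 0) (by simp)).1 (by simpa using hft)
  have hxu : x ∈ u := mem_of_mem_nhdsWithin (mem_insert x t) hu
  have hus : u ∈ 𝓝[s] x := nhdsWithin_mono x (hst.trans (subset_insert x t)) hu
  have hsmul_near (a : 𝕜') (v : E) : ∀ᶠ y in 𝓝[s] x, f' y (a • v) = a • f' y v := by
    filter_upwards [eventually_eventually_nhdsWithin.2 hus, self_mem_nhdsWithin] with y hy hys
    rw [hs.nhdsWithin_eq hys] at hy
    have hderiv : HasFDerivAt f (f' y) y := (hf' y (mem_of_mem_nhds hy)).hasFDerivAt hy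
    have hderiv' := ((hfs y hys).differentiableAt (hs.mem_nhds hys)).hasFDerivAt
    simp [hderiv.unique (hderiv'.restrictScalars 𝕜)]
  have htendsto (v : E) : Tendsto (fun y => f' y v) (𝓝[s] x) (𝓝 (f' x v)) :=
    (hf'_cont.continuousWithinAt.clm_apply continuousWithinAt_const).mono_left
      (nhdsWithin_le_iff.2 hus)
  have : (𝓝[s] x).NeBot := mem_closure_iff_nhdsWithin_neBot.1 hx
  let L : E →L[𝕜'] F :=
    { f' x with
      map_smul' := fun a v => tendsto_nhds_unique_of_eventuallyEq (htendsto (a • v))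
        ((htendsto v).const_smul a) (hsmul_near a v) }
  exact ⟨L, .of_restrictScalars 𝕜 (((hf' x hxu).mono_of_mem_nhdsWithin hu).mono
    (subset_insert x t)) rfl⟩

theorem exists_hasMFDerivWithinAt_of_contMDiffWithinAt {𝕜 𝕜' E F X : Type*}
    [NontriviallyNormedField 𝕜] [NontriviallyNormedField 𝕜'] [NormedAlgebra 𝕜 𝕜']
    [NormedAddCommGroup E] [NormedSpace 𝕜 E] [NormedSpace 𝕜' E] [IsScalarTower 𝕜 𝕜' E]
    [NormedAddCommGroup F] [NormedSpace 𝕜 F] [NormedSpace 𝕜' F] [IsScalarTower 𝕜 𝕜' F]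
    [TopologicalSpace X] [ChartedSpace E X] [IsManifold 𝓘(𝕜', E) 1 X]
    {f : X → F} {S T : Set X} {x : X} (hfT : ContMDiffWithinAt 𝓘(𝕜, E) 𝓘(𝕜, F) 1 f T x)
    (hS : IsOpen S) (hST : S ⊆ T) (hfS : MDifferentiableOn 𝓘(𝕜', E) 𝓘(𝕜', F) f S)
    (hx : x ∈ closure S) :
    ∃ f' : TangentSpace 𝓘(𝕜', E) x →L[𝕜'] F,
      HasMFDerivWithinAt 𝓘(𝕜', E) 𝓘(𝕜', F) f T x f' := by
  let φ := chartAt E x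
  have hxφ : x ∈ φ.source := mem_chart_source E x
  have hopen : IsOpen (φ.target ∩ φ.symm ⁻¹' S) := φ.isOpen_inter_preimage_symm hS
  have hdiff : DifferentiableOn 𝕜' (f ∘ φ.symm) (φ.target ∩ φ.symm ⁻¹' S) := fun z hz =>
    (mdifferentiableAt_iff_differentiableAt.1 (((hfS _ hz.2).mdifferentiableAt
      (hS.mem_nhds hz.2)).comp z (mdifferentiableAt_atlas_symm (chart_mem_atlas E x)
        hz.1))).differentiableWithinAt
  have hclosure : φ x ∈ closure (φ.target ∩ φ.symm ⁻¹' S) := by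
    refine mem_closure_iff_frequently.2 ((φ.continuousAt hxφ).frequently ?_)
    refine ((mem_closure_iff_frequently.1 hx).and_eventually
      (φ.open_source.eventually_mem hxφ)).mono fun y hy => ⟨φ.map_source hy.2, ?_⟩
    simpa only [mem_preimage, φ.left_inv hy.2] using hy.1
  have hC1 := (contMDiffWithinAt_iff.1 hfT).2
  simp only [mfld_simps] at hC1
  obtain ⟨f', hf'⟩ := exists_hasFDerivWithinAt_of_contDiffWithinAt hC1 hopen
    (fun z hz => hST hz.2) hdiff hclosure
  refine ⟨f', hfT.continuousWithinAt, ?_⟩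
  simp only [mfld_simps]
  exact hf'

theorem iUnion_eventuallyEq_of_mem {ι X : Type*} [TopologicalSpace X] {F : ι → Set X}
    (hF : LocallyFinite F) (hclosed : ∀ i, IsClosed (F i))
    (hdisj : Pairwise (Function.onFun Disjoint F)) {i : ι} {x : X} (hx : x ∈ F i) :
    (⋃ j, F j) =ᶠ[𝓝 x] F i := by
  filter_upwards [hF.iInter_compl_mem_nhds hclosed x] with y hy
  refine propext ⟨fun h => ?_, mem_iUnion_of_mem (s := F) i⟩
  obtain ⟨j, hj⟩ := mem_iUnion.1 h
  have hxj : x ∈ F j := by_contra fun hxj => mem_iInter₂.1 hy j hxj hj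
  rwa [hdisj.eq (not_disjoint_iff.2 ⟨x, hx, hxj⟩)]

theorem subset_of_isPreconnected_of_disjoint_frontier {X : Type*} [TopologicalSpace X]
    {s u : Set X} (hs : IsPreconnected s) (hu : IsOpen u) (hsu : (s ∩ u).Nonempty)
    (hdisj : Disjoint s (frontier u)) : s ⊆ u :=
  hs.subset_of_closure_inter_subset hu hsu fun _ hy => by_contra fun hyu =>
    disjoint_left.1 hdisj hy.2 (hu.frontier_eq ▸ ⟨hy.1, hyu⟩)

theorem frequently_im_ne_zero : ∃ᶠ w : ℂ in 𝓝 0, w.im ≠ 0 := by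
  intro him
  have hzero : ∀ᶠ y in map im (𝓝 0), y = 0 := him.mono fun w hw => not_not.1 hw
  obtain ⟨y, hy, hy0⟩ := (hzero.filter_mono (isOpenMap_im.nhds_le 0)).exists_gt
  exact hy.ne' hy0

theorem ball_mul_I_subset_ball_inter_im_pos (r : ℝ) :
    ball (r * I) r ⊆ ball 0 (2 * r) ∩ {w | 0 < w.im} := by
  intro w hw
  rw [mem_ball_iff_norm] at hw
  have him : |w.im - r| < r := by simpa using (abs_im_le_norm (w - r * I)).trans_lt hw
  refine ⟨mem_ball_zero_iff.2 ?_, (sub_lt_sub_iff_right r).1 (by simpa using (abs_lt.1 him).1)⟩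
  have hr : 0 < r := (norm_nonneg _).trans_lt hw
  calc ‖w‖ = ‖w - r * I + r * I‖ := by rw [sub_add_cancel]
    _ ≤ ‖w - r * I‖ + ‖r * I‖ := norm_add_le _ _
    _ < r + r := add_lt_add_of_lt_of_le hw (by simp [abs_of_pos hr])
    _ = 2 * r := (two_mul r).symm

section AnalyticArcs

variable {X : Type*} [TopologicalSpace X] [ChartedSpace ℂ X]

theorem nhds_le_map_nhds_of_not_eventually_eq [IsManifold 𝓘(ℂ, ℂ) 1 X]
    {Γ : ℂ → X} {z : ℂ} (hΓ : ∀ᶠ w in 𝓝 z, MDifferentiableAt 𝓘(ℂ, ℂ) 𝓘(ℂ, ℂ) Γ w)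
    (hne : ¬ ∀ᶠ w in 𝓝 z, Γ w = Γ z) : 𝓝 (Γ z) ≤ map Γ (𝓝 z) := by
  let φ := chartAt ℂ (Γ z)
  have hzφ : Γ z ∈ φ.source := mem_chart_source ℂ (Γ z)
  have hsource : ∀ᶠ w in 𝓝 z, Γ w ∈ φ.source :=
    hΓ.self_of_nhds.continuousAt.eventually (φ.open_source.eventually_mem hzφ)
  have hanalytic : AnalyticAt ℂ (φ ∘ Γ) z := by
    refine analyticAt_iff_eventually_differentiableAt.2 ?_
    filter_upwards [hΓ, hsource] with w hw hwφ
    exact mdifferentiableAt_iff_differentiableAt.1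
      ((mdifferentiableAt_atlas (chart_mem_atlas ℂ (Γ z)) hwφ).comp w hw)
  have hopen : 𝓝 (φ (Γ z)) ≤ map (φ ∘ Γ) (𝓝 z) := by
    refine hanalytic.eventually_constant_or_nhds_le_map_nhds.resolve_left fun hconst => hne ?_
    filter_upwards [hconst, hsource] with w hw hwφ using φ.injOn hwφ hzφ hw
  calc 𝓝 (Γ z) = map φ.symm (𝓝 (φ (Γ z))) := (φ.symm_map_nhds_eq hzφ).symm
    _ ≤ map φ.symm (map (φ ∘ Γ) (𝓝 z)) := map_mono hopen
    _ = map Γ (𝓝 z) := map_congr (hsource.mono fun w hw => φ.left_inv hw)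

theorem IsSimpleClosedAnalyticCurve.isCompact {C : Set X}
    (hC : IsSimpleClosedAnalyticCurve C) : IsCompact C := by
  obtain ⟨U, γ, -, hU, hγ, -, rfl⟩ := hC
  exact (isCompact_sphere 0 1).image_of_continuousOn (hγ.continuousOn.mono hU)

/-- `A` is an analytic arc at `x` if a holomorphic map sending `0` to `x` pulls `A` back, near `0`,
to the real axis. The map need not be a local coordinate, so `x` may also be an end point. -/
def IsAnalyticArcAt (A : Set X) (x : X) : Prop :=
  ∃ Γ : ℂ → X, Γ 0 = x ∧
    ∀ᶠ w in 𝓝 0, MDifferentiableAt 𝓘(ℂ, ℂ) 𝓘(ℂ, ℂ) Γ w ∧ (Γ w ∈ A ↔ w.im = 0)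

theorem IsAnalyticArcAt.congr {A B : Set X} {x : X} (hA : IsAnalyticArcAt A x)
    (hAB : A =ᶠ[𝓝 x] B) : IsAnalyticArcAt B x := by
  obtain ⟨Γ, rfl, hΓ⟩ := hA
  refine ⟨Γ, rfl, ?_⟩
  filter_upwards [hΓ, hΓ.self_of_nhds.1.continuousAt.eventually (eventuallyEq_set.1 hAB)]
    with w hw hwAB
  exact ⟨hw.1, hwAB.symm.trans hw.2⟩

theorem IsAnalyticArcAt.mem {A : Set X} {x : X} (hA : IsAnalyticArcAt A x) : x ∈ A := by
  obtain ⟨Γ, rfl, hΓ⟩ := hA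
  exact hΓ.self_of_nhds.2.2 zero_im

theorem IsSimpleClosedAnalyticCurve.isAnalyticArcAt {C : Set X}
    (hC : IsSimpleClosedAnalyticCurve C) {x : X} (hx : x ∈ C) : IsAnalyticArcAt C x := by
  obtain ⟨U, γ, hU, hsU, hγ, hinj, rfl⟩ := hC
  obtain ⟨p, hp, rfl⟩ := hx
  -- `|exp (I * w)| = exp (-im w)`, so `e` straightens the circle to the real axis.
  let e : ℂ → ℂ := fun w => p * exp (I * w)
  have he : Differentiable ℂ e := by fun_prop
  have he_zero : e 0 = p := by simp [e]
  have he_sphere (w : ℂ) : e w ∈ sphere 0 1 ↔ w.im = 0 := by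
    simp [e, norm_exp, mem_sphere_zero_iff_norm.1 hp]
  have heU : ∀ᶠ w in 𝓝 0, e w ∈ U :=
    he.continuous.continuousAt.eventually (hU.eventually_mem (he_zero ▸ hsU hp))
  refine ⟨γ ∘ e, congrArg γ he_zero, heU.mono fun w hw => ⟨?_, ?_⟩⟩
  · exact ((hγ (e w) hw).mdifferentiableAt (hU.mem_nhds hw)).comp w (he w).mdifferentiableAt
  · rw [Function.comp_apply, hinj.mem_image_iff hsU hw, he_sphere]

theorem IsFiniteRiemannSurface.isAnalyticArcAt_frontier [T2Space X] {S : Set X}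
    (hS : IsFiniteRiemannSurface S) {x : X} (hx : x ∈ frontier S) :
    IsAnalyticArcAt (frontier S) x := by
  obtain ⟨𝒞, hfinite, hdisj, hcurve, hunion⟩ := hS.exists_curves
  have : Finite 𝒞 := hfinite.to_subtype
  obtain ⟨C, hC, hxC⟩ := mem_sUnion.1 (hunion ▸ hx)
  have hfrontier : frontier S =ᶠ[𝓝 x] C := by
    rw [← hunion, sUnion_eq_iUnion]
    exact iUnion_eventuallyEq_of_mem (F := ((↑) : 𝒞 → Set X)) (i := ⟨C, hC⟩)
      (locallyFinite_of_finite _) (fun D => (hcurve D D.2).isCompact.isClosed) hdisj.subtype hxC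
  exact ((hcurve C hC).isAnalyticArcAt hxC).congr hfrontier.symm

theorem IsAnalyticArcAt.exists_frequently_im_pos_and_mem [IsManifold 𝓘(ℂ, ℂ) 1 X]
    {S : Set X} {x : X} (hx : IsAnalyticArcAt (frontier S) x) (hS : IsOpen S) :
    ∃ Γ : ℂ → X, Γ 0 = x ∧
      (∀ᶠ w in 𝓝 0, MDifferentiableAt 𝓘(ℂ, ℂ) 𝓘(ℂ, ℂ) Γ w ∧ (Γ w ∈ frontier S ↔ w.im = 0)) ∧
      ∃ᶠ w in 𝓝 0, 0 < w.im ∧ Γ w ∈ S := by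
  have hx_closure : x ∈ closure S := frontier_subset_closure hx.mem
  obtain ⟨Γ, rfl, hΓ⟩ := hx
  have hne : ¬ ∀ᶠ w in 𝓝 0, Γ w = Γ 0 := fun hconst => by
    refine frequently_im_ne_zero ?_
    filter_upwards [hΓ, hconst] with w hw hw0
    exact not_not.2 (hw.2.1 (hw0 ▸ hΓ.self_of_nhds.2.2 zero_im))
  have hS_freq : ∃ᶠ w in 𝓝 0, Γ w ∈ S := frequently_map.1 <|
    (mem_closure_iff_frequently.1 hx_closure).filter_mono
      (nhds_le_map_nhds_of_not_eventually_eq (hΓ.mono fun w hw => hw.1) hne)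
  have hsides : ∃ᶠ w in 𝓝 0, (0 < w.im ∧ Γ w ∈ S) ∨ (w.im < 0 ∧ Γ w ∈ S) := by
    refine (hS_freq.and_eventually hΓ).mono fun w hw => ?_
    have him : w.im ≠ 0 := fun h =>
      disjoint_left.1 (disjoint_frontier_iff_isOpen.2 hS) (hw.2.2.2 h) hw.1
    exact him.lt_or_gt.symm.imp (⟨·, hw.1⟩) (⟨·, hw.1⟩)
  rcases frequently_or_distrib.1 hsides with hupper | hlower
  · exact ⟨Γ, rfl, hΓ, hupper⟩
  · have hneg : Tendsto Neg.neg (𝓝 (0 : ℂ)) (𝓝 0) := by simpa using tendsto_neg (0 : ℂ)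
    refine ⟨Γ ∘ Neg.neg, by simp, ?_, hneg.frequently (hlower.mono fun w hw => by simpa using hw)⟩
    filter_upwards [hneg.eventually hΓ] with w hw
    exact ⟨hw.1.comp w differentiable_neg.differentiableAt.mdifferentiableAt, by simpa using hw.2⟩

theorem IsAnalyticArcAt.exists_inner_disc [IsManifold 𝓘(ℂ, ℂ) 1 X] {S : Set X} {x : X}
    (hx : IsAnalyticArcAt (frontier S) x) (hS : IsOpen S) :
    ∃ (Γ : ℂ → X) (r : ℝ), 0 < r ∧ Γ 0 = x ∧ MDifferentiableAt 𝓘(ℂ, ℂ) 𝓘(ℂ, ℂ) Γ 0 ∧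
      MDifferentiableOn 𝓘(ℂ, ℂ) 𝓘(ℂ, ℂ) Γ (ball (r * I) r) ∧ MapsTo Γ (ball (r * I) r) S := by
  obtain ⟨Γ, rfl, hΓ, hfreq⟩ := hx.exists_frequently_im_pos_and_mem hS
  obtain ⟨r, hr, hball⟩ := eventually_nhds_iff_ball.1 hΓ
  let D : Set ℂ := ball 0 r ∩ {w | 0 < w.im}
  have hdisc : ball ((r / 2 : ℝ) * I) (r / 2) ⊆ D := by
    simpa only [mul_div_cancel₀ r two_ne_zero] using ball_mul_I_subset_ball_inter_im_pos (r / 2)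
  have hdiff : MDifferentiableOn 𝓘(ℂ, ℂ) 𝓘(ℂ, ℂ) Γ D := fun w hw =>
    (hball w hw.1).1.mdifferentiableWithinAt
  have hpreconn : IsPreconnected (Γ '' D) :=
    ((convex_ball 0 r).inter (convex_halfSpace_im_gt 0)).isPreconnected.image Γ hdiff.continuousOn
  have hmeets : (Γ '' D ∩ S).Nonempty := by
    obtain ⟨w, ⟨him, hwS⟩, hw⟩ := (hfreq.and_eventually (ball_mem_nhds 0 hr)).exists
    exact ⟨Γ w, mem_image_of_mem Γ ⟨hw, him⟩, hwS⟩
  have hdisj : Disjoint (Γ '' D) (frontier S) := by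
    rw [disjoint_left, forall_mem_image]
    exact fun w hw hwS => hw.2.ne' ((hball w hw.1).2.1 hwS)
  have hDS : MapsTo Γ D S := mapsTo_iff_image_subset.2
    (subset_of_isPreconnected_of_disjoint_frontier hpreconn hS hmeets hdisj)
  exact ⟨Γ, r / 2, half_pos hr, rfl, hΓ.self_of_nhds.1, hdiff.mono hdisc, hDS.mono_left hdisc⟩

end AnalyticArcs

theorem mainTheorem8_general {X : Type*} [TopologicalSpace X] [ChartedSpace ℂ X]
    [IsManifold 𝓘(ℂ, ℂ) 1 X] {H : Type*} [NormedAddCommGroup H] [InnerProductSpace ℂ H]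
    {S T : Set X} {x : X} {f : X → H} (hS : IsOpen S) (hx : IsAnalyticArcAt (frontier S) x)
    (hf : MDifferentiableOn 𝓘(ℂ, ℂ) 𝓘(ℂ, H) f S) (hfS : MapsTo f S (ball 0 1))
    (hST : S ⊆ T) (hxT : x ∈ T) (hfT : ContMDiffWithinAt 𝓘(ℝ, ℂ) 𝓘(ℝ, H) 1 f T x)
    (hfx : f x ∈ sphere 0 1) : MeetsSphereTransversallyAt f T x := by
  obtain ⟨f', hf'⟩ := exists_hasMFDerivWithinAt_of_contMDiffWithinAt hfT hS hST hf
    (frontier_subset_closure hx.mem)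
  obtain ⟨Γ, r, hr, rfl, hΓ, hΓ_diff, hΓS⟩ := hx.exists_inner_disc hS
  have hmaps : MapsTo Γ (insert 0 (ball (r * I) r)) T :=
    forall_mem_insert.2 ⟨hxT, hΓS.mono_right hST⟩
  have hderiv := (hf'.comp 0 hΓ.hasMFDerivAt.hasMFDerivWithinAt hmaps).hasFDerivWithinAt
  have hnorm : ∀ z ∈ ball (r * I) r, ‖f (Γ z)‖ < ‖f (Γ 0)‖ := fun z hz => by
    simpa only [mem_sphere_zero_iff_norm.1 hfx] using mem_ball_zero_iff.1 (hfS (hΓS hz))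
  have hcenter : (0 : ℂ) ∈ sphere (r * I) r := by simp [abs_of_pos hr]
  have hinner := inner_hasFDerivWithinAt_ne_zero_of_norm_lt hcenter hr.ne'
    (hf.comp hΓ_diff hΓS).differentiableOn hnorm hderiv
  refine ⟨f', hf', fun v hv hv0 => hinner ?_⟩
  obtain ⟨a, ha⟩ : ∃ a : ℂ, a • v = mfderiv 𝓘(ℂ, ℂ) 𝓘(ℂ, ℂ) Γ 0 (1 : ℂ) :=
    exists_smul_eq_of_finrank_eq_one (Module.finrank_self ℂ) hv _
  change inner ℂ (f (Γ 0)) (f' (mfderiv 𝓘(ℂ, ℂ) 𝓘(ℂ, ℂ) Γ 0 (1 : ℂ))) = 0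
  rw [← ha, map_smul, inner_smul_right, hv0, mul_zero]

theorem mainTheorem8
    {X : Type*} [TopologicalSpace X] [T2Space X] [CompactSpace X]
    [ChartedSpace ℂ X] [IsManifold 𝓘(ℂ, ℂ) ω X]
    {H : Type*} [NormedAddCommGroup H] [InnerProductSpace ℂ H] [CompleteSpace H]
    (S : Set X) (hS : IsFiniteRiemannSurface S)
    (f : X → H) (hf : MDifferentiableOn 𝓘(ℂ, ℂ) 𝓘(ℂ, H) f S)
    (hfS : Set.MapsTo f S (Metric.ball (0 : H) 1)) :
    (∀ x₀ ∈ frontier S,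
      ContMDiffOn 𝓘(ℝ, ℂ) 𝓘(ℝ, H) 1 f (S ∪ {x₀}) →
      f x₀ ∈ Metric.sphere (0 : H) 1 →
      MeetsSphereTransversallyAt f (S ∪ {x₀}) x₀) ∧
    (ContMDiffOn 𝓘(ℝ, ℂ) 𝓘(ℝ, H) 1 f (closure S) →
      ∀ x ∈ frontier S, f x ∈ Metric.sphere (0 : H) 1 →
      MeetsSphereTransversallyAt f (closure S) x) := by
  have htransversal {T : Set X} (hST : S ⊆ T) {x : X} (hx : x ∈ frontier S) (hxT : x ∈ T)
      (hfT : ContMDiffOn 𝓘(ℝ, ℂ) 𝓘(ℝ, H) 1 f T) (hfx : f x ∈ sphere 0 1) :=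
    mainTheorem8_general hS.isOpen (hS.isAnalyticArcAt_frontier hx) hf hfS hST hxT (hfT x hxT) hfx
  exact ⟨fun x₀ hx₀ hC1 => htransversal subset_union_left hx₀ (mem_union_right S rfl) hC1,
    fun hC1 x hx => htransversal subset_closure hx (frontier_subset_closure hx) hC1⟩
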